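/- Let $n\ge 1$ and $N=2n+1$. Let $V$ be the $(n+1)$-dimensional real vector space spanned by vectors $\tilde e_i$ ($i\in\mathbb Z$) subject to the relations $\tilde e_{i+N}=\tilde e_i+\tilde e_N$ and $\tilde e_{-i}=-\tilde e_i$. The positive roots of the affine root system of type $\widetilde C_n$ are $$\Phi^+=\{\tilde e_j-\tilde e_i : i,j\in\mathbb Z,\ i<j,\ N\nmid i,\ N\nmid j,\ i\not\equiv j \bmod N\}\subset V .$$ A set $J\subseteq\Phi^+$ is *closed* if for all $\alpha,\beta,\gamma\in\Phi^+$ with $\gamma\in\mathbb R_{>0}\alpha+\mathbb R_{>0}\beta$, if $\alpha,\beta\in J$ then $\gamma\in J$. It is *biclosed* if both $J$ and $\Phi^+\setminus J$ are closed. Let $\mathrm{bic}(\widetilde C_n)$ be the set of all biclosed subsets of $\Phi^+$, partially ordered by inclusion. **Theorem.** For every $n\ge 1$, the poset $\mathrm{bic}(\widetilde C_n)$ is a complete lattice: every family of biclosed sets has a least upper bound and a greatest lower bound in $\mathrm{bic}(\widetilde C_n)$. -/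

import Mathlib

namespace AffineC

/-- The period `N = 2n + 1`. -/
def period (n : ℕ) : ℕ := 2 * n + 1

/-- The `(n+1)`-dimensional real vector space with coordinates along `ε_1, …, ε_n`
(the first component) and along `δ` (the second component). -/
abbrev V (n : ℕ) : Type := (Fin n → ℝ) × ℝ

/-- The vectors `ẽ_i`, `i ∈ ℤ`. Write `i = r + q N` with `-n ≤ r ≤ n` (so `r = Int.bmod i N` and
`q = Int.bdiv i N`). Then `ẽ_i = ε_r + q δ`, where `ε_{-r} = -ε_r` and `ε_0 = 0`.
The coordinate `a : Fin n` stands for the index `a + 1 ∈ {1, …, n}`. -/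
noncomputable def e (n : ℕ) (i : ℤ) : V n :=
  (fun a => if Int.bmod i (period n) = (a : ℤ) + 1 then 1
            else if Int.bmod i (period n) = -((a : ℤ) + 1) then -1 else 0,
   (Int.bdiv i (period n) : ℝ))

/-- The remainder and the quotient in the definition of `ẽ_i`. -/
theorem bmod_bdiv_eq (n : ℕ) (r q : ℤ) (h₁ : -(n : ℤ) ≤ r) (h₂ : r ≤ n) :
    Int.bmod (r + q * (period n : ℤ)) (period n) = r ∧
      Int.bdiv (r + q * (period n : ℤ)) (period n) = q := by
  have hm : Int.bmod (r + q * (period n : ℤ)) (period n) = r := by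
    rw [Int.add_mul_bmod_self_right]
    apply Int.bmod_eq_of_le <;> simp only [period] <;> omega
  refine ⟨hm, ?_⟩
  have h := Int.bmod_add_bdiv (r + q * (period n : ℤ)) (period n)
  rw [hm] at h
  have hN : (period n : ℤ) ≠ 0 := by simp only [period]; omega
  apply mul_left_cancel₀ hN
  linarith

/-- Every integer is `r + q N` with `-n ≤ r ≤ n`. -/
theorem exists_rep (n : ℕ) (i : ℤ) :
    ∃ r q : ℤ, -(n : ℤ) ≤ r ∧ r ≤ n ∧ i = r + q * (period n : ℤ) := by
  refine ⟨Int.bmod i (period n), Int.bdiv i (period n), ?_, ?_, ?_⟩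
  · have := Int.le_bmod (x := i) (m := period n) (by simp [period])
    simp only [period] at this ⊢; omega
  · have := Int.bmod_lt (x := i) (m := period n) (by simp [period])
    simp only [period] at this ⊢; omega
  · have := Int.bmod_add_bdiv i (period n)
    linarith

theorem e_rep (n : ℕ) (r q : ℤ) (h₁ : -(n : ℤ) ≤ r) (h₂ : r ≤ n) :
    e n (r + q * (period n : ℤ)) =
      (fun a : Fin n => if r = (a : ℤ) + 1 then 1 else if r = -((a : ℤ) + 1) then -1 else 0, (q : ℝ)) := by
  obtain ⟨hr, hq⟩ := bmod_bdiv_eq n r q h₁ h₂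
  simp only [e, hr, hq]

/-- The first defining relation: `ẽ_{i+N} = ẽ_i + ẽ_N`. -/
theorem e_add_period (n : ℕ) (i : ℤ) :
    e n (i + (period n : ℤ)) = e n i + e n (period n : ℤ) := by
  obtain ⟨r, q, h₁, h₂, rfl⟩ := exists_rep n i
  have hN := e_rep n 0 1 (by omega) (by omega)
  have h := e_rep n r (q + 1) h₁ h₂
  rw [show r + (q + 1) * (period n : ℤ) = r + q * (period n : ℤ) + period n by ring] at h
  rw [show (0 : ℤ) + 1 * (period n : ℤ) = period n by ring] at hN
  rw [h, hN, e_rep n r q h₁ h₂]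
  ext a
  · have h1 : (0 : ℤ) ≠ (a : ℤ) + 1 := by omega
    have h2 : (0 : ℤ) ≠ -((a : ℤ) + 1) := by omega
    simp only [Prod.mk_add_mk, Pi.add_apply, if_neg h1, if_neg h2, add_zero]
  · simp

/-- The second defining relation: `ẽ_{-i} = -ẽ_i`. -/
theorem e_neg (n : ℕ) (i : ℤ) : e n (-i) = -e n i := by
  obtain ⟨r, q, h₁, h₂, rfl⟩ := exists_rep n i
  rw [show -(r + q * (period n : ℤ)) = -r + (-q) * (period n : ℤ) by ring,
    e_rep n (-r) (-q) (by omega) (by omega), e_rep n r q h₁ h₂]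
  ext a
  · simp only [Prod.neg_mk, Pi.neg_apply]
    split_ifs <;> first | omega | simp
  · simp

/-- The positive roots of type `C̃_n`: the vectors `β_{ij} = ẽ_j - ẽ_i` for integers `i < j`
which are not divisible by `N` and not congruent to each other modulo `N`. -/
def posRoots (n : ℕ) : Set (V n) :=
  {β | ∃ i j : ℤ, i < j ∧ ¬ (period n : ℤ) ∣ i ∧ ¬ (period n : ℤ) ∣ j ∧
    ¬ i ≡ j [ZMOD (period n : ℤ)] ∧ β = e n j - e n i}

/-- A set `J` of positive roots is closed if every positive root that is a strictly positive
real combination of two elements of `J` lies in `J`. -/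
def IsClosedSet (n : ℕ) (J : Set (V n)) : Prop :=
  ∀ α ∈ posRoots n, ∀ β ∈ posRoots n, ∀ γ ∈ posRoots n,
    (∃ a b : ℝ, 0 < a ∧ 0 < b ∧ γ = a • α + b • β) → α ∈ J → β ∈ J → γ ∈ J

/-- The collection of biclosed sets of positive roots of type `C̃_n`; as a type, it is ordered
by inclusion. -/
def bic (n : ℕ) : Set (Set (V n)) :=
  {J | J ⊆ posRoots n ∧ IsClosedSet n J ∧ IsClosedSet n (posRoots n \ J)}

end AffineC

/-! A root is a class of index pairs `i < j`, so a biclosed set resembles the inversion set of a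
total order on the integers not divisible by `N`, invariant under translation by `N` and reversed by
negation. Inversion sets of such orders are the relations that are both transitive and cotransitive,
and joins of these are easy: the transitive closure of a union of inversion sets is again
cotransitive (`isInversionRel_transGen`).

The obstacle is that an order also compares congruent indices, and these pairs give no root.
`imagExt` adds a congruent pair only when two related pairs already sum to a multiple of `δ`.
Biclosedness makes the result transitive and cotransitive (`ClosedRel.imagExt_trans`,
`ClosedRel.imagExt_cotrans`), and minimality of the choice makes it monotone in the biclosed set
(`imagExt_mono`).

Conversely, every symmetric order inverts a biclosed set of roots
(`IsSymmOrder.invertedRoots_mem_bic`); this rests on a classification of positive combinations in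
type C (`signedCoord_cases`). The join of a family is therefore given by the transitive closure of
the union of the extensions: the extension of any upper bound is transitive and contains each of
them, hence contains the closure. Meets follow by complementation. -/

namespace AffineC

/-! ### Extending closed relations to congruent pairs -/

/-- `i < j`, neither divisible by `N`, and not congruent to each other modulo `N`. -/
def RealPair (N i j : ℤ) : Prop := i < j ∧ ¬ N ∣ i ∧ ¬ N ∣ j ∧ ¬ N ∣ j - i

/-- The closure properties, in terms of index pairs, of a closed set of roots. -/
structure ClosedRel (N : ℤ) (T : ℤ → ℤ → Prop) : Prop where
  real : ∀ {i j}, T i j → RealPair N i j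
  shift : ∀ {i j} (c : ℤ), T i j → T (i + c * N) (j + c * N)
  neg : ∀ {i j}, T i j → T (-j) (-i)
  trans : ∀ {i j k}, T i j → T j k → ¬ N ∣ k - i → T i k
  convex : ∀ {i j a b c}, T i (j + a * N) → T i (j + b * N) → a ≤ c → c ≤ b → T i (j + c * N)
  ray : ∀ {i j a b}, T i j → T j (i + a * N) → 0 ≤ b → T i (j + b * N)

/-- The class of `i` is inverted: some pair of related pairs sums to a multiple of `δ`. -/
def ImagForced (N : ℤ) (T : ℤ → ℤ → Prop) (i : ℤ) : Prop := ∃ j a, T i j ∧ T j (i + a * N)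

/-- Extension of a relation on real pairs to congruent pairs. -/
def imagExt (N : ℤ) (T : ℤ → ℤ → Prop) (i j : ℤ) : Prop :=
  T i j ∨ (i < j ∧ N ∣ j - i ∧ ImagForced N T i)

theorem exists_nonneg_lt_mul {N : ℤ} (hN : 0 < N) (x : ℤ) : ∃ d : ℤ, 0 ≤ d ∧ x < d * N :=
  ⟨|x| + 1, by positivity, by nlinarith [le_abs_self x, abs_nonneg x]⟩

theorem not_dvd_add_mul {N i : ℤ} (h : ¬ N ∣ i) (c : ℤ) : ¬ N ∣ i + c * N := by
  simpa [Int.dvd_add_left (Dvd.intro_left c rfl : N ∣ c * N)] using h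

theorem pos_of_lt_add_mul {N i a : ℤ} (hN : 0 < N) (h : i < i + a * N) : 0 < a := by
  by_contra! h'
  nlinarith

theorem exists_eq_add_mul {N i j : ℤ} (h : N ∣ j - i) : ∃ c : ℤ, j = i + c * N := by
  obtain ⟨c, hc⟩ := h
  exact ⟨c, by linarith⟩

namespace ClosedRel

variable {N : ℤ} {T : ℤ → ℤ → Prop}

theorem unshift (h : ClosedRel N T) {i j : ℤ} (c : ℤ) (hT : T (i + c * N) (j + c * N)) : T i j := by
  simpa using h.shift (-c) hT

theorem imagForced_shift (h : ClosedRel N T) {i : ℤ} (c : ℤ) (hi : ImagForced N T i) :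
    ImagForced N T (i + c * N) := by
  obtain ⟨j, a, h₁, h₂⟩ := hi
  refine ⟨j + c * N, a, h.shift c h₁, ?_⟩
  convert h.shift c h₂ using 1
  ring

theorem imagForced_neg (h : ClosedRel N T) {i : ℤ} (hi : ImagForced N T i) :
    ImagForced N T (-i) := by
  obtain ⟨j, a, h₁, h₂⟩ := hi
  refine ⟨-j + a * N, a, ?_, h.shift a (h.neg h₁)⟩
  convert h.shift a (h.neg h₂) using 1
  ring

theorem imagForced_not_dvd (h : ClosedRel N T) {i : ℤ} (hi : ImagForced N T i) : ¬ N ∣ i := by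
  obtain ⟨j, a, h₁, -⟩ := hi
  exact (h.real h₁).2.1

theorem imagExt_lt (h : ClosedRel N T) {i j : ℤ} (hE : imagExt N T i j) : i < j := by
  rcases hE with hE | hE
  exacts [(h.real hE).1, hE.1]

theorem imagExt_not_dvd_left (h : ClosedRel N T) {i j : ℤ} (hE : imagExt N T i j) : ¬ N ∣ i := by
  rcases hE with hE | hE
  exacts [(h.real hE).2.1, h.imagForced_not_dvd hE.2.2]

theorem imagExt_neg (h : ClosedRel N T) {i j : ℤ} (hE : imagExt N T i j) :
    imagExt N T (-j) (-i) := by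
  rcases hE with hE | ⟨h₁, h₂, h₃⟩
  · exact Or.inl (h.neg hE)
  · obtain ⟨c, rfl⟩ := exists_eq_add_mul h₂
    refine Or.inr ⟨by linarith, ⟨c, by ring⟩, h.imagForced_neg (h.imagForced_shift c h₃)⟩

theorem imagExt_not_dvd_right (h : ClosedRel N T) {i j : ℤ} (hE : imagExt N T i j) : ¬ N ∣ j := by
  simpa using h.imagExt_not_dvd_left (h.imagExt_neg hE)

theorem imagExt_shift (h : ClosedRel N T) {i j : ℤ} (c : ℤ) (hE : imagExt N T i j) :
    imagExt N T (i + c * N) (j + c * N) := by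
  rcases hE with hE | ⟨h₁, h₂, h₃⟩
  · exact Or.inl (h.shift c hE)
  · exact Or.inr ⟨by linarith, by simpa using h₂, h.imagForced_shift c h₃⟩

/-- The loop `j → m → j + b * N` can be run any number of times after `i → j`, and `convex` fills
the gaps. If `m` is congruent to `i` the chain would pass through a pair that is not real, but then
`ray` applies directly. -/
theorem add_mul_of_imagForced (h : ClosedRel N T) (hN : 0 < N) {i j a : ℤ} (hij : T i j)
    (hj : ImagForced N T j) (ha : 0 ≤ a) : T i (j + a * N) := by
  obtain ⟨m, b, h₁, h₂⟩ := hj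
  by_cases hm : N ∣ m - i
  · obtain ⟨c, rfl⟩ := exists_eq_add_mul hm
    exact h.ray hij h₁ ha
  have hb : 0 < b := pos_of_lt_add_mul hN ((h.real h₁).1.trans (h.real h₂).1)
  have key : ∀ r : ℕ, T i (j + (r * b) * N) := by
    intro r
    induction r with
    | zero => simpa using hij
    | succ r ih =>
      have h₃ := h.trans ih (h.shift (r * b) h₁) (by
        rw [show m + r * b * N - i = m - i + (r * b) * N by ring]
        exact not_dvd_add_mul hm _)
      have h₄ := h.trans h₃ (h.shift (r * b) h₂) (by
        rw [show j + b * N + r * b * N - i = j - i + (b + r * b) * N by ring]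
        exact not_dvd_add_mul (h.real hij).2.2.2 _)
      convert h₄ using 1
      push_cast
      ring
  have h₀ : T i (j + 0 * N) := by simpa using hij
  refine h.convex h₀ (key a.toNat) ha ?_
  rw [Int.toNat_of_nonneg ha]
  nlinarith

theorem imagExt_trans (h : ClosedRel N T) (hN : 0 < N) {i j k : ℤ} (h₁ : imagExt N T i j)
    (h₂ : imagExt N T j k) : imagExt N T i k := by
  have step : ∀ {i j k : ℤ}, T i j → j < k → N ∣ k - j → ImagForced N T j → imagExt N T i k := by
    intro i j k hT hlt hd hF
    obtain ⟨c, rfl⟩ := exists_eq_add_mul hd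
    exact Or.inl (h.add_mul_of_imagForced hN hT hF (pos_of_lt_add_mul hN hlt).le)
  rcases h₁ with h₁ | ⟨h₁, d₁, f₁⟩ <;> rcases h₂ with h₂ | ⟨h₂, d₂, f₂⟩
  · by_cases hd : N ∣ k - i
    · refine Or.inr ⟨(h.real h₁).1.trans (h.real h₂).1, hd, ?_⟩
      obtain ⟨c, rfl⟩ := exists_eq_add_mul hd
      exact ⟨j, c, h₁, h₂⟩
    · exact Or.inl (h.trans h₁ h₂ hd)
  · exact step h₁ h₂ d₂ f₂
  · obtain ⟨c, rfl⟩ := exists_eq_add_mul d₁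
    have := step (h.neg h₂) (k := -i) (by linarith) (by simp)
      (h.imagForced_neg (h.imagForced_shift c f₁))
    simpa using h.imagExt_neg this
  · exact Or.inr ⟨h₁.trans h₂, by simpa using dvd_add d₁ d₂, f₁⟩

variable {T' : ℤ → ℤ → Prop}

/-- Two loops through `i`, one in each relation, would put a common real pair in both. -/
theorem imagForced_not_both (h : ClosedRel N T) (h' : ClosedRel N T') (hN : 0 < N)
    (hd : ∀ i j, T i j → ¬ T' i j) (hc : ∀ i j, RealPair N i j → T i j ∨ T' i j) {i : ℤ}
    (hi : ImagForced N T i) : ¬ ImagForced N T' i := by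
  rintro ⟨j, a, j₁, j₂⟩
  obtain ⟨m, b, m₁, m₂⟩ := hi
  by_cases hm : N ∣ j - m
  · obtain ⟨c, rfl⟩ := exists_eq_add_mul hm
    refine hd _ _ (h.ray (b := c + |c|) m₁ m₂ (by linarith [neg_abs_le c])) ?_
    convert h'.ray (b := |c|) j₁ j₂ (abs_nonneg c) using 1
    ring
  · obtain ⟨r, hr₀, hr₁⟩ := exists_nonneg_lt_mul hN (m - j)
    -- `d` is large enough that `(m, j + d * N)` is a real pair and that `a + d - b` is nonnegative
    -- for the final use of `ray`.
    obtain ⟨d, hd₀, hd₁, hlt⟩ : ∃ d : ℤ, 0 ≤ d ∧ b - a ≤ d ∧ m < j + d * N :=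
      ⟨r + |b - a|, by positivity, by linarith [le_abs_self (b - a)],
        by nlinarith [abs_nonneg (b - a)]⟩
    have hpair : RealPair N m (j + d * N) :=
      ⟨hlt, (h.real m₁).2.2.1, not_dvd_add_mul (h'.real j₁).2.2.1 d, by
        rw [show j + d * N - m = j - m + d * N by ring]; exact not_dvd_add_mul hm d⟩
    rcases hc _ _ hpair with hT | hT
    · refine hd _ _ (h.trans m₁ hT ?_) (h'.ray j₁ j₂ hd₀)
      rw [show j + d * N - i = j - i + d * N by ring]
      exact not_dvd_add_mul (h'.real j₁).2.2.2 d
    · have hne : ¬ N ∣ i + a * N + d * N - m := by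
        rw [show i + a * N + d * N - m = i + b * N - m + (a + d - b) * N by ring]
        exact not_dvd_add_mul (h.real m₂).2.2.2 _
      refine hd _ _ ?_ (h'.trans hT (h'.shift d j₂) hne)
      have := h.ray (a := b) (b := a + d - b) m₂ (h.shift b m₁) (by linarith)
      convert this using 1
      ring

/-- Otherwise `T'` relates `i + a * N` to `k`; as `i` is not forced, `T'` also relates `k` to a far
translate of `i`. Then `ray` for `T'` puts `(i, k)` itself in `T'`. -/
theorem mem_of_add_mul_mem (h : ClosedRel N T) (h' : ClosedRel N T') (hN : 0 < N)
    (hd : ∀ i j, T i j → ¬ T' i j) (hc : ∀ i j, RealPair N i j → T i j ∨ T' i j) {i k a : ℤ}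
    (ha : 0 ≤ a) (hT : T i k) (hF : ¬ ImagForced N T i) (hlt : i + a * N < k) :
    T (i + a * N) k := by
  obtain ⟨-, hi, hk, hik⟩ := h.real hT
  by_contra hn
  have hT' : T' (i + a * N) k := (hc _ _ ⟨hlt, not_dvd_add_mul hi a, hk, by
    rw [show k - (i + a * N) = k - i + (-a) * N by ring]
    exact not_dvd_add_mul hik _⟩).resolve_left hn
  obtain ⟨m, hm₀, hm₁⟩ := exists_nonneg_lt_mul hN (k - i)
  have hki : T' k (i + m * N) := (hc _ _ ⟨by linarith, hk, not_dvd_add_mul hi m, fun hdvd => by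
    rw [show i + m * N - k = -(k - i) + m * N by ring] at hdvd
    exact not_dvd_add_mul (by rwa [Int.dvd_neg]) m hdvd⟩).resolve_left
      fun hT₂ => hF ⟨k, m, hT, hT₂⟩
  have := h'.ray (a := m - a) (b := a) hT' (by convert hki using 1; ring) ha
  exact hd _ _ hT (h'.unshift a this)

/-- If `j` is congruent to `i`, either `i` is forced or `mem_of_add_mul_mem` applies; `j` congruent
to `k` is the negated case. Otherwise both halves in `T'` would put `(i, k)` in `T'` or make `i`
forced in both relations. -/
theorem imagExt_cotrans (h : ClosedRel N T) (h' : ClosedRel N T') (hN : 0 < N)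
    (hd : ∀ i j, T i j → ¬ T' i j) (hc : ∀ i j, RealPair N i j → T i j ∨ T' i j) {i j k : ℤ}
    (hE : imagExt N T i k) (hij : i < j) (hjk : j < k) (hj : ¬ N ∣ j) :
    imagExt N T i j ∨ imagExt N T j k := by
  have hi := h.imagExt_not_dvd_left hE
  have hk := h.imagExt_not_dvd_right hE
  have step : ∀ {i j k : ℤ}, T i k → i < j → j < k → N ∣ j - i →
      imagExt N T i j ∨ imagExt N T j k := by
    intro i j k hT hij hjk hdvd
    by_cases hF : ImagForced N T i
    · exact Or.inl (Or.inr ⟨hij, hdvd, hF⟩)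
    · obtain ⟨a, rfl⟩ := exists_eq_add_mul hdvd
      exact Or.inr (Or.inl (h.mem_of_add_mul_mem h' hN hd hc (pos_of_lt_add_mul hN hij).le
        hT hF hjk))
  by_cases dij : N ∣ j - i
  · rcases hE with hT | ⟨-, -, hF⟩
    · exact step hT hij hjk dij
    · exact Or.inl (Or.inr ⟨hij, dij, hF⟩)
  by_cases djk : N ∣ k - j
  · rcases hE with hT | ⟨-, hdvd, -⟩
    · have hdvd : N ∣ -j - -k := by rwa [show -j - -k = k - j by ring]
      rcases step (h.neg hT) (neg_lt_neg hjk) (neg_lt_neg hij) hdvd with hE | hE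
      · exact Or.inr (by simpa using h.imagExt_neg hE)
      · exact Or.inl (by simpa using h.imagExt_neg hE)
    · exact absurd (by simpa using dvd_sub hdvd djk) dij
  rcases hc i j ⟨hij, hi, hj, dij⟩ with h₁ | h₁
  · exact Or.inl (Or.inl h₁)
  rcases hc j k ⟨hjk, hj, hk, djk⟩ with h₂ | h₂
  · exact Or.inr (Or.inl h₂)
  exfalso
  rcases hE with hT | ⟨-, hdvd, hF⟩
  · exact hd _ _ hT (h'.trans h₁ h₂ (h.real hT).2.2.2)
  · obtain ⟨a, rfl⟩ := exists_eq_add_mul hdvd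
    exact h.imagForced_not_both h' hN hd hc hF ⟨j, a, h₁, h₂⟩

end ClosedRel

theorem imagExt_mono {N : ℤ} {T S : ℤ → ℤ → Prop} (h : ∀ i j, T i j → S i j) {i j : ℤ}
    (hE : imagExt N T i j) : imagExt N S i j := by
  rcases hE with hE | ⟨h₁, h₂, m, a, h₃, h₄⟩
  · exact Or.inl (h _ _ hE)
  · exact Or.inr ⟨h₁, h₂, m, a, h _ _ h₃, h _ _ h₄⟩

/-! ### Signed coordinates and positive combinations of roots in type C -/

open Classical in
/-- The coefficient along the basis vector labelled `x` of the signed basis vector labelled `s`. -/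
noncomputable def signedCoord {G : Type*} [AddCommGroup G] (x s : G) : ℝ :=
  if s = x then 1 else if s = -x then -1 else 0

section SignedCoord

variable {G : Type*} [AddCommGroup G]

theorem signedCoord_trichotomy (s x : G) :
    x = s ∨ -x = s ∨ (s ≠ x ∧ s ≠ -x ∧ signedCoord x s = 0 ∧ signedCoord s x = 0) := by
  by_cases h : s = x
  · exact Or.inl h.symm
  by_cases h' : s = -x
  · exact Or.inr (Or.inl h'.symm)
  refine Or.inr (Or.inr ⟨h, h', by simp [signedCoord, h, h'], ?_⟩)
  rw [signedCoord, if_neg (Ne.symm h), if_neg (by rintro rfl; simp at h')]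

theorem signedCoord_self (x : G) : signedCoord x x = 1 := by simp [signedCoord]

theorem signedCoord_neg (hG : ∀ x : G, x = -x → x = 0) {x : G} (hx : x ≠ 0) (s : G) :
    signedCoord x (-s) = - signedCoord x s := by
  have : x ≠ -x := fun h => hx (hG x h)
  have h' : -x ≠ x := fun h => hx (hG x h.symm)
  unfold signedCoord
  by_cases h : s = x
  · simp [h, h']
  by_cases h1 : s = -x
  · simp [h1, h']
  have : -s ≠ x := fun h2 => h1 (by rw [← h2, neg_neg])
  simp [h, h1, this]

theorem signedCoord_neg_left (hG : ∀ x : G, x = -x → x = 0) {x : G} (hx : x ≠ 0) (s : G) :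
    signedCoord (-x) s = - signedCoord x s := by
  have : x ≠ -x := fun h => hx (hG x h)
  have h' : -x ≠ x := fun h => hx (hG x h.symm)
  unfold signedCoord
  by_cases h : s = x
  · simp [h, this]
  by_cases h1 : s = -x
  · simp [h1, h']
  simp [h, h1]

theorem signedCoord_trichotomy₂ (s x y : G) : x = s ∨ -x = s ∨ y = s ∨ -y = s ∨
    ((s ≠ x ∧ s ≠ -x ∧ signedCoord x s = 0 ∧ signedCoord s x = 0) ∧
      (s ≠ y ∧ s ≠ -y ∧ signedCoord y s = 0 ∧ signedCoord s y = 0)) := by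
  have h₁ := signedCoord_trichotomy s x
  have h₂ := signedCoord_trichotomy s y
  tauto

theorem signedCoord_trichotomy₃ (s x y z : G) : x = s ∨ -x = s ∨ y = s ∨ -y = s ∨ z = s ∨ -z = s ∨
    ((s ≠ x ∧ s ≠ -x ∧ signedCoord x s = 0 ∧ signedCoord s x = 0) ∧
      (s ≠ y ∧ s ≠ -y ∧ signedCoord y s = 0 ∧ signedCoord s y = 0) ∧
      (s ≠ z ∧ s ≠ -z ∧ signedCoord z s = 0 ∧ signedCoord s z = 0)) := by
  have h₁ := signedCoord_trichotomy₂ s x y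
  have h₂ := signedCoord_trichotomy s z
  tauto

set_option maxHeartbeats 2000000 in
/-- The ways in which a root `k + l` of a type `C` system is a positive combination of two roots
`k + j` and `p + q`, written in terms of signed basis vectors. -/
theorem signedCoord_cases (hG : ∀ x : G, x = -x → x = 0) {k l j p q : G} {a b : ℝ}
    (ha : 0 < a) (hb : 0 < b) (hk : k ≠ 0) (hl : l ≠ 0) (hj : j ≠ 0) (hp : p ≠ 0) (hq : q ≠ 0)
    (hkl : l ≠ -k) (hkj : j ≠ -k) (hpq : q ≠ -p)
    (h : ∀ x, x ≠ 0 → signedCoord x k + signedCoord x l =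
      a * (signedCoord x k + signedCoord x j) +
      b * (signedCoord x p + signedCoord x q)) :
    (a = 1 ∧ b = 1 ∧ (p = l ∧ q = -j ∨ q = l ∧ p = -j)) ∨
    (a = 1/2 ∧ b = 1/2 ∧ j = k ∧ p = l ∧ q = l) ∨
    (l = k ∧ a = 2 ∧ b = 1 ∧ p = -j ∧ q = -j) ∨
    (j = l ∧ a + b = 1 ∧ (p = k ∧ q = l ∨ q = k ∧ p = l)) ∨
    (j = l ∧ a - b = 1 ∧ (p = -k ∧ q = -l ∨ q = -k ∧ p = -l)) := by
  have h1 := h k hk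
  have h2 := h l hl
  have h3 := h j hj
  have h4 := h p hp
  have h5 := h q hq
  clear h
  -- The numerical form of `hpq`, which `linarith` can use.
  have h6 : 0 < 1 + signedCoord p q := by
    unfold signedCoord
    split_ifs <;> first | contradiction | norm_num
  rcases signedCoord_trichotomy l k with rfl | rfl | ⟨l1, l2, l3, l4⟩
  · rcases signedCoord_trichotomy j k with rfl | rfl | ⟨m1, m2, m3, m4⟩
    · rcases signedCoord_trichotomy p k with rfl | rfl | ⟨n1, n2, n3, n4⟩ <;>
        rcases signedCoord_trichotomy q k with rfl | rfl | ⟨o1, o2, o3, o4⟩ <;>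
        simp [signedCoord_self, signedCoord_neg hG, signedCoord_neg_left hG, *]
          at h1 h2 h3 h4 h5 h6 hpq ⊢ <;>
        first | linarith | grind
    · simp at hkj
    · rcases signedCoord_trichotomy₂ p k j with rfl | rfl | rfl | rfl |
          ⟨⟨n1, n2, n3, n4⟩, r1, r2, r3, r4⟩ <;>
        rcases signedCoord_trichotomy₂ q k j with rfl | rfl | rfl | rfl |
          ⟨⟨o1, o2, o3, o4⟩, s1, s2, s3, s4⟩ <;>
        simp [signedCoord_self, signedCoord_neg hG, signedCoord_neg_left hG, *]
          at h1 h2 h3 h4 h5 h6 hpq ⊢ <;>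
        first | linarith | grind
  · simp at hkl
  · rcases signedCoord_trichotomy₂ j k l with rfl | rfl | rfl | rfl | ⟨⟨m1, m2, m3, m4⟩, v1, v2, v3, v4⟩
    · rcases signedCoord_trichotomy₂ p k l with rfl | rfl | rfl | rfl |
          ⟨⟨n1, n2, n3, n4⟩, r1, r2, r3, r4⟩ <;>
        rcases signedCoord_trichotomy₂ q k l with rfl | rfl | rfl | rfl |
          ⟨⟨o1, o2, o3, o4⟩, s1, s2, s3, s4⟩ <;>
        simp [signedCoord_self, signedCoord_neg hG, signedCoord_neg_left hG, *]
          at h1 h2 h3 h4 h5 h6 hpq ⊢ <;>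
        first | linarith | grind
    · simp at hkj
    · rcases signedCoord_trichotomy₂ p k l with rfl | rfl | rfl | rfl |
          ⟨⟨n1, n2, n3, n4⟩, r1, r2, r3, r4⟩ <;>
        rcases signedCoord_trichotomy₂ q k l with rfl | rfl | rfl | rfl |
          ⟨⟨o1, o2, o3, o4⟩, s1, s2, s3, s4⟩ <;>
        simp [signedCoord_self, signedCoord_neg hG, signedCoord_neg_left hG, *]
          at h1 h2 h3 h4 h5 h6 hpq ⊢ <;>
        first | linarith | grind
    · rcases signedCoord_trichotomy₂ p k l with rfl | rfl | rfl | rfl |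
          ⟨⟨n1, n2, n3, n4⟩, r1, r2, r3, r4⟩ <;>
        rcases signedCoord_trichotomy₂ q k l with rfl | rfl | rfl | rfl |
          ⟨⟨o1, o2, o3, o4⟩, s1, s2, s3, s4⟩ <;>
        simp [signedCoord_self, signedCoord_neg hG, signedCoord_neg_left hG, *]
          at h1 h2 h3 h4 h5 h6 hpq ⊢ <;>
        first | linarith | grind
    · rcases signedCoord_trichotomy₃ p k l j with rfl | rfl | rfl | rfl | rfl | rfl |
          ⟨⟨n1, n2, n3, n4⟩, ⟨r1, r2, r3, r4⟩, t1, t2, t3, t4⟩ <;>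
        rcases signedCoord_trichotomy₃ q k l j with rfl | rfl | rfl | rfl | rfl | rfl |
          ⟨⟨o1, o2, o3, o4⟩, ⟨s1, s2, s3, s4⟩, u1, u2, u3, u4⟩ <;>
        simp [signedCoord_self, signedCoord_neg hG, signedCoord_neg_left hG, *]
          at h1 h2 h3 h4 h5 h6 hpq ⊢ <;>
        first | linarith | grind

end SignedCoord

/-! ### Symmetric total orders -/

/-- A total order on the integers not divisible by `N`, invariant under translation by `N` and
reversed by negation. -/
structure IsSymmOrder (N : ℤ) (R : ℤ → ℤ → Prop) : Prop where
  valid : ∀ {i j}, R i j → ¬ N ∣ i ∧ ¬ N ∣ j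
  trans : ∀ {i j k}, R i j → R j k → R i k
  irrefl : ∀ i, ¬ R i i
  total : ∀ {i j}, ¬ N ∣ i → ¬ N ∣ j → i ≠ j → R i j ∨ R j i
  shift : ∀ {i j} (c : ℤ), R i j → R (i + c * N) (j + c * N)
  neg : ∀ {i j}, R i j → R (-j) (-i)

namespace IsSymmOrder

variable {N : ℤ} {R : ℤ → ℤ → Prop}

theorem reverse (h : IsSymmOrder N R) : IsSymmOrder N (fun i j => R j i) where
  valid hR := (h.valid hR).symm
  trans h₁ h₂ := h.trans h₂ h₁
  irrefl := h.irrefl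
  total hi hj hij := (h.total hi hj hij).symm
  shift c hR := h.shift c hR
  neg hR := h.neg hR

theorem nat_mul_step (h : IsSymmOrder N R) {i c : ℤ} (hR : R i (i + c * N)) (r : ℕ) :
    R i (i + ((r + 1) * c) * N) := by
  induction r with
  | zero => simpa using hR
  | succ r ih =>
    refine h.trans ih ?_
    convert h.shift ((r + 1) * c) hR using 1
    push_cast
    ring

/-- A congruence class cannot be both increasing and decreasing. -/
theorem not_opposite (h : IsSymmOrder N R) {i c d : ℤ} (hc : 0 < c) (hd : d < 0)
    (h₁ : R i (i + c * N)) (h₂ : R i (i + d * N)) : False := by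
  -- `-d` steps by `c` and `c` steps by `d` together return to `i`. Since `nat_mul_step` makes `r +
  -- 1` steps, the counts are lowered by one.
  obtain ⟨r, hr⟩ := Int.eq_ofNat_of_zero_le (by omega : 0 ≤ -d - 1)
  obtain ⟨s, hs⟩ := Int.eq_ofNat_of_zero_le (by omega : 0 ≤ c - 1)
  have k₁ := h.nat_mul_step h₁ r
  have k₂ := h.shift (-d * c) (h.nat_mul_step h₂ s)
  rw [show (r : ℤ) + 1 = -d by omega] at k₁
  rw [show (s : ℤ) + 1 = c by omega, show i + c * d * N + -d * c * N = i by ring] at k₂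
  exact h.irrefl _ (h.trans k₁ k₂)

end IsSymmOrder

/-! ### Convexity of the roots inverted by a symmetric order -/

variable {n : ℕ}

theorem period_pos (n : ℕ) : (0 : ℤ) < period n := by simp only [period]; omega

theorem e_add_mul_period (i c : ℤ) :
    e n (i + c * (period n : ℤ)) = e n i + ((0, (c : ℝ)) : V n) := by
  obtain ⟨r, q, h₁, h₂, rfl⟩ := exists_rep n i
  rw [show r + q * (period n : ℤ) + c * (period n : ℤ) = r + (q + c) * (period n : ℤ) by ring,
    e_rep n r _ h₁ h₂, e_rep n r _ h₁ h₂]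
  ext <;> simp

theorem zmod_eq_zero_of_eq_neg (x : ZMod (period n)) (h : x = -x) : x = 0 := by
  have h₂ : (2 : ZMod (period n)) * x = 0 := by linear_combination h
  have h₃ : ((2 * n + 1 : ℕ) : ZMod (period n)) = 0 := ZMod.natCast_self (period n)
  rw [Nat.cast_add, Nat.cast_mul, Nat.cast_two, Nat.cast_one] at h₃
  linear_combination x * h₃ - (n : ZMod (period n)) * h₂

theorem zmod_eq_iff {i j : ℤ} : ((i : ZMod (period n)) = j) ↔ (period n : ℤ) ∣ j - i :=
  ZMod.intCast_eq_intCast_iff_dvd_sub i j (period n)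

theorem zmod_eq_zero_iff {i : ℤ} : ((i : ZMod (period n)) = 0) ↔ (period n : ℤ) ∣ i :=
  ZMod.intCast_zmod_eq_zero_iff_dvd i (period n)

theorem exists_eq_of_zmod_eq {i j : ℤ} (h : (i : ZMod (period n)) = j) :
    ∃ c : ℤ, i = j + c * (period n : ℤ) :=
  exists_eq_add_mul (zmod_eq_iff.1 h.symm)

theorem zmod_eq_iff_of_bounded {r s q t : ℤ} (h₁ : -(n : ℤ) ≤ r) (h₂ : r ≤ n) (h₃ : -(n : ℤ) ≤ s)
    (h₄ : s ≤ n) :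
    ((r + q * (period n : ℤ) : ℤ) : ZMod (period n)) =
      ((s + t * (period n : ℤ) : ℤ) : ZMod (period n)) ↔ r = s := by
  have : ((r + q * (period n : ℤ) : ℤ) : ZMod (period n)) =
      ((s + t * (period n : ℤ) : ℤ) : ZMod (period n)) ↔
     ((r : ℤ) : ZMod (period n)) = ((s : ℤ) : ZMod (period n)) := by simp
  rw [this, zmod_eq_iff]
  constructor
  · intro h
    by_contra hne
    have hpos : 0 < |s - r| := abs_pos.2 (by omega)
    have := Int.le_of_dvd (a := period n) hpos (by simpa using h)
    simp only [period] at this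
    push_cast at this
    have := abs_le.2 (⟨by omega, by omega⟩ : -(2 * (n : ℤ)) ≤ s - r ∧ s - r ≤ 2 * n)
    omega
  · rintro rfl
    simp

theorem exists_coord (x : ℤ) (hx : ¬ (period n : ℤ) ∣ x) :
    ∃ φ : V n →ₗ[ℝ] ℝ, ∀ s : ℤ, φ (e n s) = signedCoord (x : ZMod (period n)) s := by
  obtain ⟨r, q, h₁, h₂, rfl⟩ := exists_rep n x
  have hr : r ≠ 0 := by rintro rfl; simp at hx
  have hneg : ∀ s t : ℤ, ((s + t * (period n : ℤ) : ℤ) : ZMod (period n)) =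
      -((r + q * (period n : ℤ) : ℤ) : ZMod (period n)) ↔
        ((s + t * (period n : ℤ) : ℤ) : ZMod (period n)) =
          ((-r + -q * (period n : ℤ) : ℤ) : ZMod (period n)) := by
    intro s t; push_cast; simp
  obtain hr | hr := hr.lt_or_gt
  · obtain ⟨m, hm⟩ := Int.eq_ofNat_of_zero_le (by omega : 0 ≤ -r - 1)
    refine ⟨-(LinearMap.proj (⟨m, by omega⟩ : Fin n)) ∘ₗ LinearMap.fst ℝ _ _, fun s => ?_⟩
    obtain ⟨s, t, h₃, h₄, rfl⟩ := exists_rep n s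
    rw [e_rep n s t h₃ h₄, signedCoord]
    simp only [hneg, zmod_eq_iff_of_bounded h₃ h₄ h₁ h₂,
      zmod_eq_iff_of_bounded h₃ h₄ (by omega : -(n : ℤ) ≤ -r) (by omega)]
    simp only [LinearMap.comp_apply, LinearMap.neg_apply, LinearMap.proj_apply, LinearMap.fst_apply]
    split_ifs <;> first | omega | simp
  · obtain ⟨m, hm⟩ := Int.eq_ofNat_of_zero_le (by omega : 0 ≤ r - 1)
    refine ⟨(LinearMap.proj (⟨m, by omega⟩ : Fin n)) ∘ₗ LinearMap.fst ℝ _ _, fun s => ?_⟩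
    obtain ⟨s, t, h₃, h₄, rfl⟩ := exists_rep n s
    rw [e_rep n s t h₃ h₄, signedCoord]
    simp only [hneg, zmod_eq_iff_of_bounded h₃ h₄ h₁ h₂,
      zmod_eq_iff_of_bounded h₃ h₄ (by omega : -(n : ℤ) ≤ -r) (by omega)]
    simp only [LinearMap.comp_apply, LinearMap.proj_apply, LinearMap.fst_apply]
    split_ifs <;> first | omega | simp

theorem signedCoord_relation {k l i j p q : ℤ} {a b : ℝ}
    (heq : e n k + e n l = a • (e n i + e n j) + b • (e n p + e n q)) (x : ZMod (period n))
    (hx : x ≠ 0) : signedCoord x k + signedCoord x l =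
      a * (signedCoord x i + signedCoord x j) + b * (signedCoord x p + signedCoord x q) := by
  obtain ⟨x, rfl⟩ := ZMod.intCast_surjective x
  obtain ⟨φ, hφ⟩ := exists_coord x (fun h => hx (zmod_eq_zero_iff.2 h))
  simpa only [map_add, map_smul, smul_eq_mul, hφ] using congrArg φ heq

theorem zmod_ne_neg {i j : ℤ} (h : ¬ (period n : ℤ) ∣ i + j) :
    (j : ZMod (period n)) ≠ -(i : ZMod (period n)) := by
  intro h'
  apply h
  rw [← zmod_eq_zero_iff]
  push_cast
  rw [h']
  ring

/-- Here `R x (-y)` says that `ẽ_x + ẽ_y` is inverted. Assuming the opposite comparison for `k` and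
`-l`, each case of `signedCoord_cases` fixes the indices modulo `N`, and the `δ`-coordinate
constrains the translations. The outcome is a cycle in `R`, or a congruence class that both
increases and decreases. -/
theorem root_mem_of_aligned {R : ℤ → ℤ → Prop} (h : IsSymmOrder (period n) R) {k l j p q : ℤ}
    {a b : ℝ} (ha : 0 < a) (hb : 0 < b) (hl : ¬ (period n : ℤ) ∣ l)
    (hkl : ¬ (period n : ℤ) ∣ k + l) (hkj : ¬ (period n : ℤ) ∣ k + j)
    (hpq : ¬ (period n : ℤ) ∣ p + q) (h₁ : R k (-j)) (h₂ : R p (-q))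
    (heq : e n k + e n l = a • (e n k + e n j) + b • (e n p + e n q)) : R k (-l) := by
  have flip : ∀ {x y : ℤ}, R x (-y) → R y (-x) := fun hR => by simpa using h.neg hR
  have hk := (h.valid h₁).1
  have hj : ¬ (period n : ℤ) ∣ j := by simpa using (h.valid h₁).2
  have hp := (h.valid h₂).1
  have hq : ¬ (period n : ℤ) ∣ q := by simpa using (h.valid h₂).2
  by_contra hn
  have h₃ : R (-l) k := (h.total (by simpa using hl) hk (by
    rintro rfl; simp at hkl)).resolve_right hn
  have h₃' : R (-k) l := by simpa using h.neg h₃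
  have h₁' := flip h₁
  have chain : ∀ {p q : ℤ}, R p (-q) → a = 1 → b = 1 →
      e n k + e n l = a • (e n k + e n j) + b • (e n p + e n q) →
      (p : ZMod (period n)) = l → (q : ZMod (period n)) = -j → False := by
    rintro p q h₂ rfl rfl heq hpl hqj
    obtain ⟨c, rfl⟩ := exists_eq_of_zmod_eq hpl
    obtain ⟨d, rfl⟩ := exists_eq_of_zmod_eq (j := -j) (by simpa using hqj)
    have hδ := congrArg Prod.snd heq
    simp [e_add_mul_period, e_neg] at hδ
    have hcd : d = -c := by
      have : (d : ℝ) = -c := by linarith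
      exact_mod_cast this
    subst hcd
    have := h.shift (-c) h₂
    have h₄ : R l j := by convert this using 1 <;> ring
    exact h.irrefl _ (h.trans h₄ (h.trans h₁' h₃'))
  have parallel : ∀ {p q : ℤ}, R p (-q) → a + b = 1 →
      e n k + e n l = a • (e n k + e n j) + b • (e n p + e n q) → (j : ZMod (period n)) = l →
      (p : ZMod (period n)) = k → (q : ZMod (period n)) = l → False := by
    intro p q h₂ hab heq hjl hpk hql
    obtain ⟨c, rfl⟩ := exists_eq_of_zmod_eq hjl
    obtain ⟨d, rfl⟩ := exists_eq_of_zmod_eq hpk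
    obtain ⟨f, rfl⟩ := exists_eq_of_zmod_eq hql
    have hδ := congrArg Prod.snd heq
    simp [e_add_mul_period] at hδ
    -- Hence `c` and `d + f` have opposite signs or both vanish, while `R` moves `-l` by `-c` and by
    -- `-(d + f)` periods.
    have hδ' : a * c + b * (d + f) = 0 := by
      linear_combination (-(e n k).2 - (e n l).2) * hab - hδ
    have h₄ : R (-l) (-l + -c * period n) := by
      refine h.trans h₃ ?_
      convert h₁ using 1; ring
    have h₅ : R (-l) (-l + -(d + f) * period n) := by
      refine h.trans h₃ ?_
      convert h.shift (-d) h₂ using 1 <;> ring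
    rcases lt_trichotomy c 0 with hc | rfl | hc
    · have hc' : (c : ℝ) < 0 := by exact_mod_cast hc
      have : (0 : ℝ) < (d + f : ℤ) := by push_cast; nlinarith
      have : 0 < d + f := by exact_mod_cast this
      exact h.not_opposite (by linarith) (by linarith) h₄ h₅
    · exact h.irrefl _ (by simpa using h₄)
    · have hc' : (0 : ℝ) < c := by exact_mod_cast hc
      have : ((d + f : ℤ) : ℝ) < 0 := by push_cast; nlinarith
      have : d + f < 0 := by exact_mod_cast this
      exact h.not_opposite (by linarith) (by linarith) h₅ h₄
  have antiparallel : ∀ {p q : ℤ}, R p (-q) → a - b = 1 →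
      e n k + e n l = a • (e n k + e n j) + b • (e n p + e n q) → (j : ZMod (period n)) = l →
      (p : ZMod (period n)) = -k → (q : ZMod (period n)) = -l → False := by
    intro p q h₂ hab heq hjl hpk hql
    obtain ⟨c, rfl⟩ := exists_eq_of_zmod_eq hjl
    obtain ⟨d, rfl⟩ := exists_eq_of_zmod_eq (j := -k) (by simpa using hpk)
    obtain ⟨f, rfl⟩ := exists_eq_of_zmod_eq (j := -l) (by simpa using hql)
    have hδ := congrArg Prod.snd heq
    simp [e_add_mul_period, e_neg] at hδ
    have hδ' : a * c + b * (d + f) = 0 := by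
      linear_combination (-(e n k).2 - (e n l).2) * hab - hδ
    have h₄ : R (-l) (-l + -c * period n) := by
      refine h.trans h₃ ?_
      convert h₁ using 1; ring
    have h₅ : R (-l) (-l + -(c + d + f) * period n) := by
      have h₆ : R (-l + (d + f) * period n) (-l + -c * period n) := by
        refine h.trans ?_ (show R k (-l + -c * period n) by convert h₁ using 1; ring)
        convert h.shift d (flip h₂) using 1 <;> ring
      convert h.shift (-(d + f)) h₆ using 1 <;> ring
    -- The same sign argument, with `c + d + f` in place of `d + f`.
    have hδ'' : b * (c + d + f) = -c := by linear_combination hδ' - c * hab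
    rcases lt_trichotomy c 0 with hc | rfl | hc
    · have hc' : (c : ℝ) < 0 := by exact_mod_cast hc
      have : (0 : ℝ) < (c + d + f : ℤ) := by push_cast; nlinarith
      have : 0 < c + d + f := by exact_mod_cast this
      exact h.not_opposite (by linarith) (by linarith) h₄ h₅
    · exact h.irrefl _ (by simpa using h₄)
    · have hc' : (0 : ℝ) < c := by exact_mod_cast hc
      have : ((c + d + f : ℤ) : ℝ) < 0 := by push_cast; nlinarith
      have : c + d + f < 0 := by exact_mod_cast this
      exact h.not_opposite (by linarith) (by linarith) h₅ h₄
  have heq' : e n k + e n l = a • (e n k + e n j) + b • (e n q + e n p) := by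
    rw [heq, add_comm (e n p)]
  rcases signedCoord_cases zmod_eq_zero_of_eq_neg ha hb (mt zmod_eq_zero_iff.1 hk)
    (mt zmod_eq_zero_iff.1 hl) (mt zmod_eq_zero_iff.1 hj) (mt zmod_eq_zero_iff.1 hp)
    (mt zmod_eq_zero_iff.1 hq) (zmod_ne_neg hkl) (zmod_ne_neg hkj) (zmod_ne_neg hpq)
    (signedCoord_relation heq) with ⟨ha₁, hb₁, ⟨c₁, c₂⟩ | ⟨c₁, c₂⟩⟩ | ⟨ha₁, hb₁, c₁, c₂, c₃⟩ |
      ⟨c₁, ha₁, hb₁, c₂, c₃⟩ | ⟨c₁, hab, ⟨c₂, c₃⟩ | ⟨c₂, c₃⟩⟩ | ⟨c₁, hab, ⟨c₂, c₃⟩ | ⟨c₂, c₃⟩⟩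
  · exact chain h₂ ha₁ hb₁ heq c₁ c₂
  · exact chain (flip h₂) ha₁ hb₁ heq' c₁ c₂
  · obtain ⟨c, rfl⟩ := exists_eq_of_zmod_eq c₁
    obtain ⟨d, rfl⟩ := exists_eq_of_zmod_eq c₂
    obtain ⟨f, rfl⟩ := exists_eq_of_zmod_eq c₃
    subst ha₁ hb₁
    have hδ := congrArg Prod.snd heq
    simp [e_add_mul_period] at hδ
    have hcd : c = -(d + f) := by
      have : (c : ℝ) = -(d + f) := by linarith
      exact_mod_cast this
    subst hcd
    have h₄ : R l (-l + -(d + f) * period n) := by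
      convert h.shift (-d) h₂ using 1 <;> ring
    have h₅ : R (-l + -(d + f) * period n) (k + -(d + f) * period n) := h.shift _ h₃
    exact h.irrefl _ (h.trans h₅ (h.trans h₁' (h.trans h₃' h₄)))
  · obtain ⟨c, rfl⟩ := exists_eq_of_zmod_eq c₁
    obtain ⟨d, rfl⟩ := exists_eq_of_zmod_eq (j := -j) (by simpa using c₂)
    obtain ⟨f, rfl⟩ := exists_eq_of_zmod_eq (j := -j) (by simpa using c₃)
    subst ha₁ hb₁
    have hδ := congrArg Prod.snd heq
    simp [e_add_mul_period, e_neg] at hδ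
    have hcd : c = d + f := by
      have : (c : ℝ) = d + f := by linarith
      exact_mod_cast this
    subst hcd
    have h₄ : R (-j + (d + f) * period n) j := by
      convert h.shift f h₂ using 1 <;> ring
    exact h.irrefl _ (h.trans h₄ (h.trans h₁' (h.trans h₃' (h.shift (d + f) h₁))))
  · exact parallel h₂ hab heq c₁ c₂ c₃
  · exact parallel (flip h₂) hab heq' c₁ c₂ c₃
  · exact antiparallel h₂ hab heq c₁ c₂ c₃
  · exact antiparallel (flip h₂) hab heq' c₁ c₂ c₃

/-- If `γ = a α + b β` with `α = ẽ_i + ẽ_j`, `β = ẽ_p + ẽ_q`, `γ = ẽ_k + ẽ_l`, and the order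
inverts both `α` and `β`, then it inverts `γ`. -/
theorem root_mem_of_combination {R : ℤ → ℤ → Prop} (h : IsSymmOrder (period n) R)
    {k l i j p q : ℤ} {a b : ℝ} (ha : 0 < a) (hb : 0 < b) (hk : ¬ (period n : ℤ) ∣ k)
    (hl : ¬ (period n : ℤ) ∣ l)
    (hkl : ¬ (period n : ℤ) ∣ k + l) (hij : ¬ (period n : ℤ) ∣ i + j)
    (hpq : ¬ (period n : ℤ) ∣ p + q) (h₁ : R i (-j)) (h₂ : R p (-q))
    (heq : e n k + e n l = a • (e n i + e n j) + b • (e n p + e n q)) : R k (-l) := by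
  have flip : ∀ {x y : ℤ}, R x (-y) → R y (-x) := fun hR => by simpa using h.neg hR
  have aligned : ∀ {i j p q : ℤ} {a b : ℝ}, 0 < a → 0 < b → ¬ (period n : ℤ) ∣ i + j →
      ¬ (period n : ℤ) ∣ p + q → R i (-j) → R p (-q) →
      e n k + e n l = a • (e n i + e n j) + b • (e n p + e n q) →
      (i : ZMod (period n)) = k → R k (-l) := by
    intro i j p q a b ha hb hij hpq h₁ h₂ heq hik
    obtain ⟨c, rfl⟩ := exists_eq_of_zmod_eq hik
    -- Only the sum `ẽ_i + ẽ_j` matters, so the translation is moved from the first index to the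
    -- second.
    refine root_mem_of_aligned h (j := j + c * period n) ha hb hl hkl (by
      rwa [show k + (j + c * (period n : ℤ)) = k + c * period n + j by ring]) hpq ?_ h₂ ?_
    · convert h.shift (-c) h₁ using 1 <;> ring
    · rw [heq, e_add_mul_period, e_add_mul_period]
      abel_nf
  have hk₀ : (k : ZMod (period n)) ≠ 0 := mt zmod_eq_zero_iff.1 hk
  have hpos : ∀ s : ℤ, (s : ZMod (period n)) = k ∨ signedCoord (k : ZMod (period n)) s ≤ 0 := by
    intro s
    by_cases hs : (s : ZMod (period n)) = k
    · exact Or.inl hs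
    · refine Or.inr ?_
      rw [signedCoord, if_neg hs]
      split_ifs <;> norm_num
  have hcoord := signedCoord_relation heq k hk₀
  have hl' : 0 ≤ signedCoord (k : ZMod (period n)) l := by
    rw [signedCoord, if_neg (zmod_ne_neg hkl)]
    split_ifs <;> norm_num
  rw [signedCoord_self] at hcoord
  rcases hpos i with hi | hi
  · exact aligned ha hb hij hpq h₁ h₂ heq hi
  rcases hpos j with hj | hj
  · exact aligned ha hb (by rwa [add_comm]) hpq (flip h₁) h₂ (by rw [heq, add_comm (e n i)]) hj
  rcases hpos p with hp | hp
  · exact aligned hb ha hpq hij h₂ h₁ (by rw [heq, add_comm]) hp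
  rcases hpos q with hq | hq
  · exact aligned hb ha (by rwa [add_comm]) hij (flip h₂) h₁
      (by rw [heq, add_comm, add_comm (e n p)]) hq
  -- The coefficient at `k` is at least `1` on the left, but at most `0` on the right if none of the
  -- four indices is congruent to `k`.
  nlinarith


/-! ### From closed sets of roots to relations on pairs -/

/-- The relation on index pairs given by a set of roots. -/
def pairRel (n : ℕ) (J : Set (V n)) (i j : ℤ) : Prop :=
  RealPair (period n) i j ∧ e n j - e n i ∈ J

theorem mem_posRoots_iff {β : V n} :
    β ∈ posRoots n ↔ ∃ i j : ℤ, RealPair (period n) i j ∧ β = e n j - e n i := by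
  simp only [posRoots, RealPair, Set.mem_ofPred_eq, Int.modEq_iff_dvd, and_assoc]

theorem RealPair.mem_posRoots {i j : ℤ} (h : RealPair (period n) i j) :
    e n j - e n i ∈ posRoots n :=
  mem_posRoots_iff.2 ⟨i, j, h, rfl⟩

theorem realPair_shift {N i j : ℤ} (c : ℤ) (h : RealPair N i j) :
    RealPair N (i + c * N) (j + c * N) :=
  ⟨by linarith [h.1], not_dvd_add_mul h.2.1 c, not_dvd_add_mul h.2.2.1 c, by simpa using h.2.2.2⟩

theorem realPair_neg {N i j : ℤ} (h : RealPair N i j) : RealPair N (-j) (-i) :=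
  ⟨by linarith [h.1], by simpa using h.2.2.1, by simpa using h.2.1, by
    rw [show -i - -j = j - i by ring]; exact h.2.2.2⟩

theorem closedRel_pairRel {J : Set (V n)} (hJ : IsClosedSet n J) :
    ClosedRel (period n) (pairRel n J) where
  real h := h.1
  shift c h := by
    refine ⟨realPair_shift c h.1, ?_⟩
    rw [e_add_mul_period, e_add_mul_period, add_sub_add_right_eq_sub]
    exact h.2
  neg h := by
    refine ⟨realPair_neg h.1, ?_⟩
    rw [e_neg, e_neg, neg_sub_neg]
    exact h.2
  trans h₁ h₂ hd := by
    have hr : RealPair (period n) _ _ := ⟨h₁.1.1.trans h₂.1.1, h₁.1.2.1, h₂.1.2.2.1, hd⟩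
    refine ⟨hr, hJ _ h₁.1.mem_posRoots _ h₂.1.mem_posRoots _ hr.mem_posRoots
      ⟨1, 1, one_pos, one_pos, ?_⟩ h₁.2 h₂.2⟩
    module
  convex {i j a b c} h₁ h₂ hac hcb := by
    rcases hac.eq_or_lt with rfl | hac
    · exact h₁
    rcases hcb.eq_or_lt with rfl | hcb
    · exact h₂
    have hN := period_pos n
    have hr : RealPair (period n) i (j + c * period n) := by
      refine ⟨h₁.1.1.trans (by nlinarith), h₁.1.2.1, fun h => ?_, fun h => ?_⟩
      · exact h₁.1.2.2.1 (by simpa using h)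
      · apply h₁.1.2.2.2
        rw [show j + a * (period n : ℤ) - i = j + c * period n - i + (a - c) * period n by ring]
        exact dvd_add h (Dvd.intro_left _ rfl)
    have hac' : (a : ℝ) < c := by exact_mod_cast hac
    have hcb' : (c : ℝ) < b := by exact_mod_cast hcb
    have hne : (b : ℝ) - a ≠ 0 := by linarith
    refine ⟨hr, hJ _ h₁.1.mem_posRoots _ h₂.1.mem_posRoots _ hr.mem_posRoots
      ⟨(b - c) / (b - a), (c - a) / (b - a), div_pos (by linarith) (by linarith),
        div_pos (by linarith) (by linarith), ?_⟩ h₁.2 h₂.2⟩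
    simp only [e_add_mul_period]
    ext
    · simp
      field_simp
      ring
    · simp
      field_simp
      ring
  ray {i j a b} h₁ h₂ hb := by
    rcases hb.eq_or_lt with rfl | hb
    · simpa using h₁
    have hN := period_pos n
    have ha : 0 < a := pos_of_lt_add_mul hN (h₁.1.1.trans h₂.1.1)
    have hr : RealPair (period n) i (j + b * period n) := by
      refine ⟨h₁.1.1.trans (by nlinarith), h₁.1.2.1, not_dvd_add_mul h₁.1.2.2.1 b, ?_⟩
      rw [show j + b * (period n : ℤ) - i = j - i + b * period n by ring]
      exact not_dvd_add_mul h₁.1.2.2.2 b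
    have ha' : (0 : ℝ) < a := by exact_mod_cast ha
    have hb' : (0 : ℝ) < b := by exact_mod_cast hb
    -- The two given roots sum to `a δ`, so adding `b / a` times their sum to the first adds `b δ`.
    refine ⟨hr, hJ _ h₁.1.mem_posRoots _ h₂.1.mem_posRoots _ hr.mem_posRoots
      ⟨1 + b / a, b / a, by positivity, by positivity, ?_⟩ h₁.2 h₂.2⟩
    simp only [e_add_mul_period]
    ext
    · simp
      ring
    · simp
      field_simp
      ring

/-! ### Inversion relations, symmetric orders and biclosed sets -/

/-- A set of index pairs that is the inversion set of a symmetric order. -/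
structure IsInversionRel (N : ℤ) (U : ℤ → ℤ → Prop) : Prop where
  lt : ∀ {i j}, U i j → i < j
  valid : ∀ {i j}, U i j → ¬ N ∣ i ∧ ¬ N ∣ j
  shift : ∀ {i j} (c : ℤ), U i j → U (i + c * N) (j + c * N)
  neg : ∀ {i j}, U i j → U (-j) (-i)
  trans : ∀ {i j k}, U i j → U j k → U i k
  cotrans : ∀ {i j k}, U i k → i < j → j < k → ¬ N ∣ j → U i j ∨ U j k

/-- The order with a given inversion set. -/
def inversionOrder (N : ℤ) (U : ℤ → ℤ → Prop) (i j : ℤ) : Prop :=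
  ¬ N ∣ i ∧ ¬ N ∣ j ∧ ((i < j ∧ ¬ U i j) ∨ (j < i ∧ U j i))

theorem IsInversionRel.isSymmOrder {N : ℤ} {U : ℤ → ℤ → Prop} (h : IsInversionRel N U) :
    IsSymmOrder N (inversionOrder N U) where
  valid hR := ⟨hR.1, hR.2.1⟩
  irrefl i hR := by rcases hR.2.2 with h | h <;> exact absurd h.1 (lt_irrefl i)
  total {i j} hi hj hij := by
    unfold inversionOrder
    rcases hij.lt_or_gt with hlt | hlt
    · by_cases hU : U i j <;> simp [*]
    · by_cases hU : U j i <;> simp [*]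
  shift {i j} c hR := by
    obtain ⟨hi, hj, hR⟩ := hR
    refine ⟨not_dvd_add_mul hi c, not_dvd_add_mul hj c, hR.imp ?_ ?_⟩
    · rintro ⟨hlt, hU⟩
      refine ⟨by linarith, fun hU' => hU ?_⟩
      simpa using h.shift (-c) hU'
    · rintro ⟨hlt, hU⟩
      exact ⟨by linarith, h.shift c hU⟩
  neg {i j} hR := by
    obtain ⟨hi, hj, hR⟩ := hR
    refine ⟨by simpa using hj, by simpa using hi, hR.imp ?_ ?_⟩
    · rintro ⟨hlt, hU⟩
      exact ⟨by linarith, fun hU' => hU (by simpa using h.neg hU')⟩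
    · rintro ⟨hlt, hU⟩
      exact ⟨by linarith, h.neg hU⟩
  trans {i j k} h₁ h₂ := by
    obtain ⟨hi, hj, h₁⟩ := h₁
    obtain ⟨-, hk, h₂⟩ := h₂
    refine ⟨hi, hk, ?_⟩
    rcases h₁ with ⟨h₁, u₁⟩ | ⟨h₁, u₁⟩ <;> rcases h₂ with ⟨h₂, u₂⟩ | ⟨h₂, u₂⟩
    · exact Or.inl ⟨h₁.trans h₂, fun hU => (h.cotrans hU h₁ h₂ hj).elim u₁ u₂⟩
    · rcases lt_trichotomy i k with hik | rfl | hik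
      · exact Or.inl ⟨hik, fun hU => u₁ (h.trans hU u₂)⟩
      · exact absurd u₂ u₁
      · exact Or.inr ⟨hik, (h.cotrans u₂ hik h₁ hi).resolve_right u₁⟩
    · rcases lt_trichotomy i k with hik | rfl | hik
      · exact Or.inl ⟨hik, fun hU => u₂ (h.trans u₁ hU)⟩
      · exact absurd u₁ u₂
      · exact Or.inr ⟨hik, (h.cotrans u₁ h₂ hik hk).resolve_left u₂⟩
    · exact Or.inr ⟨h₂.trans h₁, h.trans u₂ u₁⟩

/-- The roots inverted by an order. -/
def invertedRoots (n : ℕ) (R : ℤ → ℤ → Prop) : Set (V n) :=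
  {β | ∃ i j : ℤ, RealPair (period n) i j ∧ R j i ∧ β = e n j - e n i}

theorem IsSymmOrder.rel_of_combination {R : ℤ → ℤ → Prop} (h : IsSymmOrder (period n) R)
    {i j p q k l : ℤ} {a b : ℝ} (ha : 0 < a) (hb : 0 < b) (hij : RealPair (period n) i j)
    (hpq : RealPair (period n) p q) (hkl : RealPair (period n) k l) (h₁ : R j i) (h₂ : R q p)
    (heq : e n l - e n k = a • (e n j - e n i) + b • (e n q - e n p)) : R l k := by
  have := root_mem_of_combination h (k := l) (l := -k) (i := j) (j := -i) (p := q) (q := -p) ha hb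
    hkl.2.2.1 (by simpa using hkl.2.1) hkl.2.2.2 hij.2.2.2 hpq.2.2.2 (by simpa using h₁)
    (by simpa using h₂) (by simpa only [e_neg, ← sub_eq_add_neg] using heq)
  simpa using this

theorem IsSymmOrder.mem_invertedRoots {R : ℤ → ℤ → Prop} (h : IsSymmOrder (period n) R) {i j : ℤ}
    (hij : RealPair (period n) i j) : e n j - e n i ∈ invertedRoots n R ↔ R j i := by
  refine ⟨?_, fun hR => ⟨i, j, hij, hR, rfl⟩⟩
  rintro ⟨p, q, hpq, hR, heq⟩
  -- Several index pairs represent one root; writing the root as half of itself plus half of itself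
  -- shows that `R` treats them alike.
  refine h.rel_of_combination (a := 1 / 2) (b := 1 / 2) (by norm_num) (by norm_num) hpq hpq hij
    hR hR ?_
  rw [heq]
  module

theorem IsSymmOrder.isClosedSet {R : ℤ → ℤ → Prop} (h : IsSymmOrder (period n) R) :
    IsClosedSet n (invertedRoots n R) := by
  rintro α - β - γ hγ ⟨a, b, ha, hb, heq⟩ ⟨i, j, hij, h₁, rfl⟩ ⟨p, q, hpq, h₂, rfl⟩
  obtain ⟨k, l, hkl, rfl⟩ := mem_posRoots_iff.1 hγ
  exact ⟨k, l, hkl, h.rel_of_combination ha hb hij hpq hkl h₁ h₂ heq, rfl⟩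

theorem IsSymmOrder.compl_invertedRoots {R : ℤ → ℤ → Prop} (h : IsSymmOrder (period n) R) :
    posRoots n \ invertedRoots n R = invertedRoots n (fun i j => R j i) := by
  ext β
  constructor
  · rintro ⟨hβ, hn⟩
    obtain ⟨i, j, hij, rfl⟩ := mem_posRoots_iff.1 hβ
    rw [h.mem_invertedRoots hij] at hn
    exact ⟨i, j, hij, (h.total hij.2.1 hij.2.2.1 hij.1.ne).resolve_right hn, rfl⟩
  · rintro ⟨i, j, hij, hR, rfl⟩
    refine ⟨hij.mem_posRoots, ?_⟩
    rw [h.mem_invertedRoots hij]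
    exact fun hR' => h.irrefl _ (h.trans hR hR')

theorem IsSymmOrder.invertedRoots_mem_bic {R : ℤ → ℤ → Prop} (h : IsSymmOrder (period n) R) :
    invertedRoots n R ∈ bic n := by
  refine ⟨?_, h.isClosedSet, ?_⟩
  · rintro _ ⟨i, j, hij, -, rfl⟩
    exact hij.mem_posRoots
  · rw [h.compl_invertedRoots]
    exact h.reverse.isClosedSet

theorem isInversionRel_imagExt {J : Set (V n)} (hJ : J ∈ bic n) :
    IsInversionRel (period n) (imagExt (period n) (pairRel n J)) := by
  have h := closedRel_pairRel hJ.2.1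
  have h' := closedRel_pairRel hJ.2.2
  have hN := period_pos n
  exact
    { lt := h.imagExt_lt
      valid := fun hE => ⟨h.imagExt_not_dvd_left hE, h.imagExt_not_dvd_right hE⟩
      shift := h.imagExt_shift
      neg := h.imagExt_neg
      trans := h.imagExt_trans hN
      cotrans := h.imagExt_cotrans h' hN (fun i j h₁ h₂ => h₂.2.2 h₁.2) fun i j hr => by
        by_cases hm : e n j - e n i ∈ J
        exacts [Or.inl ⟨hr, hm⟩, Or.inr ⟨hr, hr.mem_posRoots, hm⟩] }

/-- For cotransitivity, an index strictly between the ends of a chain is either one of its vertices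
or lies inside a single link, which cotransitivity of that `E x` splits. -/
theorem isInversionRel_transGen {N : ℤ} {ι : Type*} {E : ι → ℤ → ℤ → Prop}
    (h : ∀ x, IsInversionRel N (E x)) :
    IsInversionRel N (Relation.TransGen fun i j => ∃ x, E x i j) where
  lt hU := by
    induction hU with
    | single hE => obtain ⟨x, hE⟩ := hE; exact (h x).lt hE
    | tail _ hE ih => obtain ⟨x, hE⟩ := hE; exact ih.trans ((h x).lt hE)
  valid hU := by
    induction hU with
    | single hE => obtain ⟨x, hE⟩ := hE; exact (h x).valid hE
    | tail _ hE ih => obtain ⟨x, hE⟩ := hE; exact ⟨ih.1, ((h x).valid hE).2⟩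
  shift c hU := hU.lift (fun i => i + c * N) fun i j ⟨x, hE⟩ => ⟨x, (h x).shift c hE⟩
  neg hU := Relation.transGen_swap.1
    (hU.lift (fun i => -i) fun i j ⟨x, hE⟩ => ⟨x, (h x).neg hE⟩)
  trans := Relation.TransGen.trans
  cotrans {i j k} hU hij hjk hj := by
    induction hU with
    | single hE =>
      obtain ⟨x, hE⟩ := hE
      exact ((h x).cotrans hE hij hjk hj).imp (fun hE => .single ⟨x, hE⟩) fun hE => .single ⟨x, hE⟩
    | @tail m k hm hE ih =>
      obtain ⟨x, hE'⟩ := hE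
      rcases lt_trichotomy j m with hjm | rfl | hmj
      · exact (ih hjm).imp id fun hU => hU.tail ⟨x, hE'⟩
      · exact Or.inl hm
      · exact ((h x).cotrans hE' hmj hjk hj).imp (fun hE => hm.tail ⟨x, hE⟩)
          fun hE => .single ⟨x, hE⟩

theorem IsInversionRel.rel_iff {N : ℤ} {U : ℤ → ℤ → Prop} (h : IsInversionRel N U) {i j : ℤ}
    (hij : i < j) : inversionOrder N U j i ↔ U i j := by
  constructor
  · rintro ⟨-, -, ⟨h₁, -⟩ | ⟨-, h₁⟩⟩
    exacts [absurd h₁ hij.not_gt, h₁]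
  · exact fun hU => ⟨(h.valid hU).2, (h.valid hU).1, Or.inr ⟨hij, hU⟩⟩

/-! ### Joins and meets -/

theorem exists_isLUB (X : Set (bic n)) : ∃ J : bic n, IsLUB X J := by
  have hE (J : bic n) := isInversionRel_imagExt J.2
  have hU := isInversionRel_transGen fun J : X => hE J.1
  have hR := hU.isSymmOrder
  refine ⟨⟨_, hR.invertedRoots_mem_bic⟩, ?_, ?_⟩
  · intro J hJ β hβ
    obtain ⟨i, j, hij, rfl⟩ := mem_posRoots_iff.1 (J.2.1 hβ)
    exact ⟨i, j, hij, (hU.rel_iff hij.1).2 (.single ⟨⟨J, hJ⟩, Or.inl ⟨hij, hβ⟩⟩), rfl⟩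
  · rintro S hS _ ⟨i, j, hij, hR', rfl⟩
    -- The closure may pass through congruent pairs even between real ends, so the comparison is
    -- made in the extension of `S`.
    have key : imagExt (period n) (pairRel n S.1) i j := by
      have hU' := (hU.rel_iff hij.1).1 hR'
      clear hR' hij
      have hsub : ∀ {i j : ℤ}, (∃ J : X, imagExt (period n) (pairRel n J.1.1) i j) →
          imagExt (period n) (pairRel n S.1) i j := fun ⟨J, hJ⟩ =>
        imagExt_mono (fun _ _ h => ⟨h.1, hS J.2 h.2⟩) hJ
      induction hU' with
      | single h => exact hsub h
      | tail _ h ih => exact (hE S).trans ih (hsub h)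
    rcases key with h | h
    · exact h.2
    · exact absurd h.2.1 hij.2.2.2

/-- The complement of a biclosed set. -/
def bicCompl (J : bic n) : bic n :=
  ⟨posRoots n \ J.1, Set.sdiff_subset, J.2.2.2, by
    rw [Set.sdiff_sdiff_cancel_left J.2.1]; exact J.2.2.1⟩

theorem bicCompl_bicCompl (J : bic n) : bicCompl (bicCompl J) = J :=
  Subtype.ext (Set.sdiff_sdiff_cancel_left J.2.1)

theorem bicCompl_le_bicCompl {J K : bic n} (h : J ≤ K) : bicCompl K ≤ bicCompl J :=
  Set.sdiff_subset_sdiff_right h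

theorem exists_isGLB (X : Set (bic n)) : ∃ J : bic n, IsGLB X J := by
  obtain ⟨J, h₁, h₂⟩ := exists_isLUB (bicCompl '' X)
  refine ⟨bicCompl J, fun K hK => ?_, fun K hK => ?_⟩
  · simpa only [bicCompl_bicCompl] using bicCompl_le_bicCompl (h₁ ⟨K, hK, rfl⟩)
  · have : J ≤ bicCompl K := h₂ (by
      rintro _ ⟨L, hL, rfl⟩
      exact bicCompl_le_bicCompl (hK hL))
    simpa only [bicCompl_bicCompl] using bicCompl_le_bicCompl this

end AffineC

theorem mainTheorem4 (n : ℕ) (hn : 1 ≤ n) (X : Set (AffineC.bic n)) :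
    (∃ J : AffineC.bic n, IsLUB X J) ∧ (∃ J : AffineC.bic n, IsGLB X J) :=
  ⟨AffineC.exists_isLUB X, AffineC.exists_isGLB X⟩
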